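/- Let $d\ge 1$ and let $A$, $B$ be standard Borel spaces; let $B$ also carry a topology (for instance a Polish topology generating its $\sigma$-algebra, or the discrete topology). Give $A^{\mathbb Z^d}$ and $B^{\mathbb Z^d}$ the product $\sigma$-algebras, and $B^{\mathbb Z^d}$ the product topology. For $j\in\mathbb Z^d$ let the shift be $(T^jx)_i=x_{i+j}$ (likewise on $B^{\mathbb Z^d}$), and for $r\in\mathbb N_0\cup\{\infty\}$ let $B_\infty(j,r)=\{i\in\mathbb Z^d:\|i-j\|_\infty\le r\}$. Let $X=(X_i)_{i\in\mathbb Z^d}$ be a family of independent, identically distributed $A$-valued random variables on a probability space. Let $\varphi:A^{\mathbb Z^d}\to B^{\mathbb Z^d}$ be measurable with $\varphi\circ T^j=T^j\circ\varphi$ for all $j\in\mathbb Z^d$, and let $$r_\varphi(x)=\inf\{r\in\mathbb N_0:\ \forall x'\in A^{\mathbb Z^d},\ x'=x\text{ on }B_\infty(0,r)\Rightarrow \varphi(x')_0=\varphi(x)_0\}\in\mathbb N_0\cup\{\infty\}$$ be its coding radius at the origin. Assume that $\varphi$ is finitary, i.e. $r_\varphi(X)<\infty$ almost surely, and that the coding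 volume has a finite second moment, i.e. $\mathbb E\big[|B_\infty(0,r_\varphi(X))|^2\big]<\infty$. Put $Y=\varphi(X)$. For a measurable $f:B^{\mathbb Z^d}\to\mathbb R$ and $j\in\mathbb Z^d$ let $\delta_jf=\sup\{|f(y)-f(y')|:\ y_\ell=y'_\ell\ \forall \ell\ne j\}\in[0,\infty]$, and let $\|\delta f\|_2=\big(\sum_{j\in\mathbb Z^d}(\delta_jf)^2\big)^{1/2}$. The function $f$ is called local if $\{j:\delta_jf>0\}$ is finite, and has the bounded-difference property if $\delta_jf<\infty$ for all $j$. Then, for every measurable, local and continuous $f:B^{\mathbb Z^d}\to\mathbb R$ with the bounded-difference property and every $\lambda>0$, the random variables $f(Y)$ and $\exp\{\lambda(f(Y)-\mathbb E f(Y))\}$ are integrable and $$\log\mathbb E\big[\exp\{\lambda(f(Y)-\mathbb E f(Y))\}\big]\ \le\ 2^d\lambda^2\,\mathbb E\big[(2r_\varphi(X)+1)^{2d}\big]\,\|\delta f\|_2^2 .$$ -/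

import Mathlib

open MeasureTheory ProbabilityTheory
open scoped ENNReal

/-- The lattice `ℤ^d`. -/
abbrev IntGrid (d : ℕ) : Type := Fin d → ℤ

/-- The shift `(T^j x)_i = x_{i+j}` on configurations. -/
def latticeShift {d : ℕ} {A : Type*} (j : IntGrid d) (x : IntGrid d → A) : IntGrid d → A :=
  fun i => x (i + j)

/-- The closed `ℓ^∞`-ball `{i : ‖i - j‖_∞ ≤ r}` of `ℤ^d`, with radius `r ∈ ℕ ∪ {∞}`. -/
def linfBall {d : ℕ} (j : IntGrid d) (r : ℕ∞) : Set (IntGrid d) :=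
  {i | ∀ k, ((i k - j k).natAbs : ℕ∞) ≤ r}

/-- The coding radius of `φ` at the origin: the least `r ∈ ℕ` such that `φ(x')_0 = φ(x)_0` for all
`x'` that agree with `x` on the ball of radius `r` around `0`; it is `∞` if there is no such `r`. -/
noncomputable def codingRadius {d : ℕ} {A B : Type*} (φ : (IntGrid d → A) → (IntGrid d → B))
    (x : IntGrid d → A) : ℕ∞ :=
  ⨅ (r : ℕ) (_ : ∀ x' : IntGrid d → A, (∀ i ∈ linfBall (0 : IntGrid d) (r : ℕ∞), x' i = x i) →
    φ x' 0 = φ x 0), (r : ℕ∞)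

/-- The coding volume `|B_∞(0, r_φ(x))|`. -/
noncomputable def codingVolume {d : ℕ} {A B : Type*} (φ : (IntGrid d → A) → (IntGrid d → B))
    (x : IntGrid d → A) : ℕ∞ :=
  (linfBall (0 : IntGrid d) (codingRadius φ x)).encard

/-- A coding map: a measurable map that commutes with all shifts. -/
structure IsCodingMap {d : ℕ} {A B : Type*} [MeasurableSpace A] [MeasurableSpace B]
    (φ : (IntGrid d → A) → (IntGrid d → B)) : Prop where
  measurable : Measurable φ
  equivariant : ∀ (j : IntGrid d) (x : IntGrid d → A),
    φ (latticeShift j x) = latticeShift j (φ x)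

/-- A coding map is finitary for the law `μ` if its coding radius is `μ`-almost surely finite. -/
structure IsFinitaryCoding {d : ℕ} {A B : Type*} [MeasurableSpace A] [MeasurableSpace B]
    (φ : (IntGrid d → A) → (IntGrid d → B)) (μ : Measure (IntGrid d → A)) : Prop
    extends IsCodingMap φ where
  radius_lt_top : ∀ᵐ x ∂μ, codingRadius φ x < ⊤

/-- The family `X = (X_i)`, `i ∈ ℤ^d`, of `A`-valued random variables is independent and
identically distributed under `P`. -/
structure IsIIDField {d : ℕ} {A Ω : Type*} [MeasurableSpace A] [MeasurableSpace Ω]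
    (X : IntGrid d → Ω → A) (P : Measure Ω) : Prop where
  measurable : ∀ i, Measurable (X i)
  indep : iIndepFun X P
  identDistrib : ∀ i j, IdentDistrib (X i) (X j) P P

/-- The configuration `(X_i(ω))_{i ∈ ℤ^d}` of the random field `X`. -/
def fieldConfig {d : ℕ} {A Ω : Type*} (X : IntGrid d → Ω → A) (ω : Ω) : IntGrid d → A :=
  fun i => X i ω

/-- The oscillation `δ_j f = sup {|f y - f y'| : y_ℓ = y'_ℓ for all ℓ ≠ j}`, in `[0, ∞]`. -/
noncomputable def osc {d : ℕ} {B : Type*} (f : (IntGrid d → B) → ℝ) (j : IntGrid d) : ℝ≥0∞ :=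
  ⨆ (y : IntGrid d → B) (y' : IntGrid d → B) (_ : ∀ l, l ≠ j → y l = y' l),
    ENNReal.ofReal |f y - f y'|

/-- The dependence set of `f`. -/
def dependenceSet {d : ℕ} {B : Type*} (f : (IntGrid d → B) → ℝ) : Set (IntGrid d) :=
  {i | 0 < osc f i}

/-- `f` is local if its dependence set is finite. -/
def IsLocalFunction {d : ℕ} {B : Type*} (f : (IntGrid d → B) → ℝ) : Prop :=
  (dependenceSet f).Finite

/-- The bounded-difference property: every oscillation is finite. -/
def HasBoundedDifferences {d : ℕ} {B : Type*} (f : (IntGrid d → B) → ℝ) : Prop :=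
  ∀ j, osc f j < ⊤

/-- `‖δf‖_p = (∑_i (δ_i f)^p)^{1/p}`, in `[0, ∞]`. -/
noncomputable def oscNorm {d : ℕ} {B : Type*} (f : (IntGrid d → B) → ℝ) (p : ℕ) : ℝ≥0∞ :=
  (∑' i, osc f i ^ p) ^ (1 / (p : ℝ))

/-!
The constant of the theorem comes from a transport-type inequality for the independent family `X`,
applied to `F = lam * f ∘ φ`.

*The inequality.* Suppose that `F x' ≤ a x + ∑ i, c i x * 1[x i ≠ x' i]` for all configurations
`x`, `x'`, where the costs `c i ≥ 0` depend on `x` only. Then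
`log ∫ exp F ≤ ∫ (a + ∑ i, c i ^ 2 / 2)`
(`integral_exp_le_of_forall_le_add_sum`). With `a = F` this controls the centred exponential
moment of `F` by the *mean* of `∑ i, c i ^ 2`; a supremum would be useless here, since the coding
radius is unbounded. The one-variable case (`integral_le_exp_integral_of_forall_le`) follows from
`exp (-u) ≤ 1 - u + u ^ 2 / 2` for `u = max (sup F - a) 0`. For the induction step, fix the values `t` and
`t'` of one coordinate in `x` and in `x'`: the hypothesis persists for the section of `F` at `t'`,
with `a` replaced by the section at `t` of `a`, plus that of `c i` if `t ≠ t'`. Hence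
`h t = log ∫ exp F(t, ·)` satisfies the one-variable hypothesis with the averages of
`a + ∑ k ≠ i, c k ^ 2 / 2` and of `c i`, and Jensen's inequality bounds the square of the latter.

*The costs.* Let `R j` be the coding radius of the configuration shifted by `j`. If `φ x` and `φ x'`
differ at `j`, then `x` and `x'` differ in the ball of radius `R j x` around `j`; so one may take
`c i = lam * ∑ j, δ_j f * 1[i ∈ B(j, R j)]`. Expanding the square,
`∑ i, c i ^ 2 = lam ^ 2 * ∑ j, ∑ k, δ_j f * δ_k f * |B(j, R j) ∩ B(k, R k)|`. Two balls that meet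
are such that the larger, doubled, contains the centre of the smaller; charging the intersection
to the larger ball and using stationarity bounds the mean by
`2 * lam ^ 2 * E[(2 R + 1) ^ d (4 R + 1) ^ d] * ‖δf‖₂ ^ 2` (`lintegral_sum_sq_le`), and
`4 R + 1 ≤ 2 (2 R + 1)` gives the stated constant.

*Infinitely many coordinates* are handled in `integral_exp_comp_le` by treating those outside a
finite set `s` as a single one. Its cost tends to zero in mean square as `s` grows, because the
radii are almost surely finite.

*Measurability.* The sublevel sets of the coding radius need not be Borel, but their complements are
projections of Borel sets, and analytic sets are universally measurable
(`MeasureTheory.AnalyticSet.nullMeasurableSet`). This provides a measurable function that dominates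
the coding radius everywhere and agrees with it almost surely, and the costs are defined by means
of it.
-/

/-! ### Universal measurability of analytic sets -/

theorem isCompact_setOf_forall_le (n : ℕ → ℕ) : IsCompact {x : ℕ → ℕ | ∀ i, x i ≤ n i} := by
  convert isCompact_univ_pi (fun i => (Set.finite_Iic (n i)).isCompact) using 1
  ext x
  simp [Pi.le_def]

/-- An open subset `V` of the Baire space that contains the box `{x | ∀ i, x i ≤ n i}` contains
one of the sets obtained by imposing only finitely many of these constraints. -/
theorem exists_forall_lt_le_subset_of_isOpen (n : ℕ → ℕ) {V : Set (ℕ → ℕ)} (hV : IsOpen V)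
    (hK : {x : ℕ → ℕ | ∀ i, x i ≤ n i} ⊆ V) : ∃ k, {x : ℕ → ℕ | ∀ i < k, x i ≤ n i} ⊆ V := by
  have hcyl : ∀ y ∈ {x : ℕ → ℕ | ∀ i, x i ≤ n i}, ∃ k, PiNat.cylinder y k ⊆ V := by
    intro y hy
    obtain ⟨v, ⟨z, k, rfl⟩, hyv, hvV⟩ :=
      (PiNat.isTopologicalBasis_cylinders (fun _ => ℕ)).exists_subset_of_mem_open (hK hy) hV
    exact ⟨k, by rwa [PiNat.mem_cylinder_iff_eq.1 hyv]⟩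
  choose! k hk using hcyl
  obtain ⟨t, ht, htc⟩ := (isCompact_setOf_forall_le n).elim_nhds_subcover
    (fun y => PiNat.cylinder y (k y))
    (fun y _ => (PiNat.isOpen_cylinder _ y (k y)).mem_nhds (PiNat.self_mem_cylinder y (k y)))
  refine ⟨t.sup k, fun x hx => ?_⟩
  -- Clipping `x` at `n` moves it into the box without changing its first coordinates.
  have hclip : (fun i => min (x i) (n i)) ∈ {x : ℕ → ℕ | ∀ i, x i ≤ n i} :=
    fun i => min_le_right _ _
  obtain ⟨y, hyt, hy⟩ := Set.mem_iUnion₂.1 (htc hclip)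
  refine hk y (ht y hyt) (PiNat.mem_cylinder_iff.2 fun i hi => ?_)
  have h1 := PiNat.mem_cylinder_iff.1 hy i hi
  rw [← h1, min_eq_left (hx i (hi.trans_le (Finset.le_sup hyt)))]

/-- Inner regularity of a finite measure on the range of a continuous function on the Baire space,
with respect to compact sets. -/
theorem exists_isCompact_subset_range_lt_measure {α : Type*} [TopologicalSpace α]
    [MeasurableSpace α] (μ : Measure α) [μ.OuterRegular] {f : (ℕ → ℕ) → α} (hf : Continuous f)
    {c : ℝ≥0∞} (hc : c < μ (Set.range f)) : ∃ K ⊆ Set.range f, IsCompact K ∧ c ≤ μ K := by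
  -- `N n k` is the set of sequences whose first `k` terms are bounded by those of `n`.
  let N : (ℕ → ℕ) → ℕ → Set (ℕ → ℕ) := fun n k => {x | ∀ i < k, x i ≤ n i}
  have hstep : ∀ (k : ℕ) (n : ℕ → ℕ), c < μ (f '' N n k) →
      ∃ m, c < μ (f '' (N n k ∩ {x | x k ≤ m})) := by
    intro k n h
    have hU : f '' N n k = ⋃ m : ℕ, f '' (N n k ∩ {x | x k ≤ m}) := by
      rw [← Set.image_iUnion, ← Set.inter_iUnion]
      congr 1
      ext x
      simp only [Set.mem_inter_iff, Set.mem_iUnion, Set.mem_ofPred_eq]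
      exact ⟨fun h => ⟨h, x k, le_rfl⟩, fun h => h.1⟩
    have hmono : Monotone fun m : ℕ => f '' (N n k ∩ {x | x k ≤ m}) := fun a b hab =>
      Set.image_mono (Set.inter_subset_inter_right _ fun x (hx : x k ≤ a) => hx.trans hab)
    rw [hU, hmono.measure_iUnion] at h
    exact lt_iSup_iff.1 h
  choose! g hg using hstep
  -- Partial sequences, extended by zeros, chosen one term at a time.
  let s : ℕ → (ℕ → ℕ) := fun k => Nat.rec (fun _ => 0) (fun k s => Function.update s k (g k s)) k
  have hs_succ : ∀ k, s (k + 1) = Function.update (s k) k (g k (s k)) := fun k => rfl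
  have hs : ∀ k, c < μ (f '' N (s k) k) := by
    intro k
    induction k with
    | zero =>
      have : N (s 0) 0 = Set.univ := by simp [N]
      rwa [this, Set.image_univ]
    | succ k ih =>
      refine (hg k _ ih).trans_le (measure_mono (Set.image_mono ?_))
      rintro x ⟨hx, hxk⟩ i hi
      rw [hs_succ]
      rcases (Nat.lt_succ_iff_lt_or_eq.1 hi) with h | rfl
      · rw [Function.update_of_ne h.ne]; exact hx i h
      · rw [Function.update_self]; exact hxk
  have hstab : ∀ k i, i < k → s k i = s (i + 1) i := by
    intro k i hik
    induction k, hik using Nat.le_induction with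
    | base => rfl
    | succ k hk ih => rw [hs_succ, Function.update_of_ne (by omega), ih]
  let n : ℕ → ℕ := fun i => s (i + 1) i
  have hN : ∀ k, N (s k) k = N n k := by
    intro k
    ext x
    exact forall₂_congr fun i hi => by rw [hstab k i hi]
  refine ⟨f '' {x | ∀ i, x i ≤ n i}, Set.image_subset_range _ _,
    (isCompact_setOf_forall_le n).image hf, ?_⟩
  rw [Set.measure_eq_iInf_isOpen]
  refine le_iInf₂ fun U hKU => le_iInf fun hU => ?_
  obtain ⟨k, hk⟩ := exists_forall_lt_le_subset_of_isOpen n (hU.preimage hf)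
    (Set.image_subset_iff.1 hKU)
  have := hs k
  rw [hN] at this
  exact this.le.trans (measure_mono (Set.image_subset_iff.2 hk))

/-- Analytic sets are universally measurable. -/
theorem MeasureTheory.AnalyticSet.nullMeasurableSet {α : Type*} [TopologicalSpace α] [T2Space α]
    [MeasurableSpace α] [BorelSpace α] (μ : Measure α) [IsFiniteMeasure μ] [μ.OuterRegular]
    {s : Set α} (hs : AnalyticSet s) : NullMeasurableSet s μ := by
  rw [AnalyticSet] at hs
  rcases hs with rfl | ⟨f, hf, rfl⟩
  · exact nullMeasurableSet_empty
  by_cases h0 : μ (Set.range f) = 0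
  · exact NullMeasurableSet.of_null h0
  obtain ⟨u, -, hu, hulim⟩ := exists_seq_strictMono_tendsto' (pos_iff_ne_zero.2 h0)
  choose K hKs hKc hKm using fun k => exists_isCompact_subset_range_lt_measure μ hf (hu k).2
  have hL : MeasurableSet (⋃ k, K k) := .iUnion fun k => (hKc k).measurableSet
  have hle : μ (Set.range f) ≤ μ (⋃ k, K k) :=
    le_of_tendsto' hulim fun k => (hKm k).trans (measure_mono (Set.subset_iUnion K k))
  exact hL.nullMeasurableSet.congr (ae_eq_of_subset_of_measure_ge (Set.iUnion_subset hKs) hle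
    hL.nullMeasurableSet (measure_ne_top _ _))

/-- The projection of a measurable set along a standard Borel space is universally measurable. -/
theorem MeasurableSet.nullMeasurableSet_image_fst {α β : Type*} [MeasurableSpace α]
    [StandardBorelSpace α] [MeasurableSpace β] [StandardBorelSpace β] (μ : Measure α)
    [IsFiniteMeasure μ] {s : Set (α × β)} (hs : MeasurableSet s) :
    NullMeasurableSet (Prod.fst '' s) μ := by
  let := upgradeStandardBorel α
  exact (hs.analyticSet_image measurable_fst).nullMeasurableSet μ

/-- An almost everywhere measurable function agrees almost everywhere with a measurable function
that dominates it everywhere. -/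
theorem AEMeasurable.exists_measurable_ge {α β : Type*} [MeasurableSpace α] [MeasurableSpace β]
    [Preorder β] [OrderTop β] {μ : Measure α} {r : α → β} (hr : AEMeasurable r μ) :
    ∃ R : α → β, Measurable R ∧ r ≤ R ∧ R =ᵐ[μ] r := by
  classical
  let N := toMeasurable μ {x | ¬ r x = hr.mk r x}
  have hN : μ N = 0 := by rw [measure_toMeasurable]; exact hr.ae_eq_mk
  refine ⟨N.piecewise (fun _ => ⊤) (hr.mk r),
    Measurable.piecewise (measurableSet_toMeasurable _ _) measurable_const hr.measurable_mk, ?_, ?_⟩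
  · intro x
    by_cases hx : x ∈ N
    · simp [hx]
    · rw [Set.piecewise_eq_of_notMem _ _ _ hx]
      have : r x = hr.mk r x := by
        by_contra h; exact hx (subset_toMeasurable _ _ h)
      exact this.le
  · filter_upwards [compl_mem_ae_iff.2 hN, hr.ae_eq_mk] with x hx h
    rw [Set.piecewise_eq_of_notMem _ _ _ hx, h]

/-- Measurability almost everywhere of a function into `ℕ∞`, from its finite sublevel sets. -/
theorem aemeasurable_enat_of_nullMeasurableSet_le {α : Type*} [MeasurableSpace α] {μ : Measure α}
    {r : α → ℕ∞} (h : ∀ n : ℕ, NullMeasurableSet {x | r x ≤ n} μ) : AEMeasurable r μ := by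
  have : NullMeasurable r μ := by
    intro S _
    rw [← Set.biUnion_preimage_singleton]
    refine NullMeasurableSet.biUnion S.to_countable fun m _ => ?_
    induction m using ENat.recTopCoe with
    | top =>
      have : r ⁻¹' {⊤} = (⋃ n : ℕ, {x | r x ≤ n})ᶜ := by
        ext x
        simp only [Set.mem_preimage, Set.mem_singleton_iff, Set.mem_compl_iff, Set.mem_iUnion,
          Set.mem_ofPred_eq, not_exists, not_le]
        exact ⟨fun h n => by simp [h], fun h => ENat.eq_top_iff_forall_gt.2 h⟩
      rw [this]
      exact (NullMeasurableSet.iUnion h).compl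
    | coe n =>
      cases n with
      | zero => convert h 0 using 1; ext x; simp
      | succ n =>
        have : r ⁻¹' {((n + 1 : ℕ) : ℕ∞)} = {x | r x ≤ ((n + 1 : ℕ) : ℕ∞)} \ {x | r x ≤ n} := by
          ext x
          simp only [Set.mem_preimage, Set.mem_singleton_iff, Set.mem_sdiff, Set.mem_ofPred_eq]
          induction r x using ENat.recTopCoe with
          | top => simpa using (ENat.natCast_ne_top (n + 1)).symm
          | coe m => norm_cast; omega
        rw [this]
        exact (h _).diff (h _)
  exact this.aemeasurable

/-! ### Concentration for functions of independent coordinates -/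

theorem Real.exp_neg_le_one_sub_add_sq {u : ℝ} (hu : 0 ≤ u) :
    Real.exp (-u) ≤ 1 - u + u ^ 2 / 2 := by
  have h := Real.quadratic_le_exp_of_nonneg hu
  have hp : 0 < 1 + u + u ^ 2 / 2 := by positivity
  rw [Real.exp_neg]
  calc (Real.exp u)⁻¹ ≤ (1 + u + u ^ 2 / 2)⁻¹ := inv_anti₀ hp h
    _ ≤ 1 - u + u ^ 2 / 2 := by
      rw [inv_le_iff_one_le_mul₀ hp]
      nlinarith [sq_nonneg (u ^ 2)]

theorem MeasureTheory.Integrable.of_measurable_of_abs_le {α : Type*} [MeasurableSpace α]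
    {μ : Measure α} [IsFiniteMeasure μ] {f : α → ℝ} (hf : Measurable f) {K : ℝ}
    (hK : ∀ x, |f x| ≤ K) : Integrable f μ :=
  .of_bound hf.aestronglyMeasurable K (.of_forall hK)

/-- The one-variable case of the concentration inequality, for `H = exp h`: if `h ≤ A` pointwise and
the *supremum* of `h` is at most `A + C` pointwise, then `log ∫ exp h ≤ ∫ (A + C ^ 2 / 2)`. -/
theorem integral_le_exp_integral_of_forall_le {T : Type*} [MeasurableSpace T] (α : Measure T)
    [IsProbabilityMeasure α] {H A C : T → ℝ} (hA : Measurable A)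
    (hC : Measurable C) (hH0 : ∀ t, 0 ≤ H t) {K : ℝ} (hAK : ∀ t, |A t| ≤ K)
    (hC0 : ∀ t, 0 ≤ C t) (hCK : ∀ t, C t ≤ K) (h1 : ∀ t, H t ≤ Real.exp (A t))
    (h2 : ∀ t t', H t' ≤ Real.exp (A t + C t)) :
    ∫ t, H t ∂α ≤ Real.exp (∫ t, (A t + C t ^ 2 / 2) ∂α) := by
  have hT : Nonempty T := α.nonempty_of_neZero
  -- The best bound that the second hypothesis gives for the supremum of `log H`.
  let M : ℝ := ⨅ t, (A t + C t)
  have hbdd : BddBelow (Set.range fun t => A t + C t) := by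
    refine ⟨-K, ?_⟩
    rintro _ ⟨t, rfl⟩
    have := (abs_le.1 (hAK t)).1
    have := hC0 t
    simp only
    linarith
  have hM : ∀ t, H t ≤ Real.exp M := by
    intro t
    rcases (hH0 t).eq_or_lt with h | h
    · rw [← h]; exact (Real.exp_pos _).le
    · rw [← Real.log_le_iff_le_exp h]
      exact le_ciInf fun t' => (Real.log_le_iff_le_exp h).2 (h2 t' t)
  have hA2 : Integrable (fun t => A t + C t ^ 2 / 2) α := by
    refine (Integrable.of_measurable_of_abs_le hA hAK).add
      ((Integrable.of_measurable_of_abs_le (hC.pow_const 2) (K := K ^ 2) fun t => ?_).div_const 2)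
    rw [abs_of_nonneg (sq_nonneg _)]
    exact pow_le_pow_left₀ (hC0 t) (hCK t) 2
  have hpt : ∀ t, H t ≤ Real.exp M * (1 - M + (A t + C t ^ 2 / 2)) := by
    intro t
    have hMA : M ≤ A t + C t := ciInf_le hbdd t
    have hu : H t ≤ Real.exp M * Real.exp (-max (M - A t) 0) := by
      rw [← Real.exp_add]
      rcases le_total (M - A t) 0 with h | h
      · rw [max_eq_right h]; simpa using hM t
      · rw [max_eq_left h]; convert h1 t using 2; ring
    refine hu.trans (mul_le_mul_of_nonneg_left ?_ (Real.exp_pos _).le)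
    refine (Real.exp_neg_le_one_sub_add_sq (le_max_right _ _)).trans ?_
    have h3 : max (M - A t) 0 ≤ C t := max_le (by linarith) (hC0 t)
    have h4 := pow_le_pow_left₀ (le_max_right (M - A t) 0) h3 2
    have h5 := le_max_left (M - A t) 0
    linarith
  calc ∫ t, H t ∂α ≤ ∫ t, Real.exp M * (1 - M + (A t + C t ^ 2 / 2)) ∂α :=
        integral_mono_of_nonneg (.of_forall hH0)
          (((integrable_const _).add hA2).const_mul _) (.of_forall hpt)
    _ = Real.exp M * (∫ t, (A t + C t ^ 2 / 2) ∂α - M + 1) := by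
        rw [integral_const_mul, integral_add (integrable_const _) hA2]
        simp
        ring
    _ ≤ Real.exp M * Real.exp (∫ t, (A t + C t ^ 2 / 2) ∂α - M) :=
        mul_le_mul_of_nonneg_left (Real.add_one_le_exp _) (Real.exp_pos _).le
    _ = _ := by rw [← Real.exp_add]; congr 1; ring

theorem sq_integral_le_integral_sq {α : Type*} [MeasurableSpace α] (μ : Measure α)
    [IsProbabilityMeasure μ] {f : α → ℝ} (hf : Measurable f) {K : ℝ} (hK : ∀ x, |f x| ≤ K) :
    (∫ x, f x ∂μ) ^ 2 ≤ ∫ x, f x ^ 2 ∂μ := by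
  refine (even_two.convexOn_pow (𝕜 := ℝ)).map_integral_le (continuous_pow 2).continuousOn
    isClosed_univ (.of_forall fun _ => Set.mem_univ _) (.of_measurable_of_abs_le hf hK)
    (.of_measurable_of_abs_le (hf.pow_const 2) (K := K ^ 2) fun x => ?_)
  rw [Function.comp_apply, abs_pow]
  exact pow_le_pow_left₀ (abs_nonneg _) (hK x) 2

theorem abs_integral_le_of_forall_abs_le {α : Type*} [MeasurableSpace α] (μ : Measure α)
    [IsProbabilityMeasure μ] {f : α → ℝ} {K : ℝ} (hK : ∀ x, |f x| ≤ K) : |∫ x, f x ∂μ| ≤ K := by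
  simpa using norm_integral_le_of_norm_le_const (μ := μ) (f := f) (.of_forall hK)

/-- Transport-type concentration for independent coordinates. If passing from `x` to `x'` raises
`a x` to at most `F x'`, at a cost `c i x` for each coordinate `i ∈ s` that is changed and `e x` for
changing anything outside `s`, then `log ∫ exp F ≤ ∫ (a + (∑ i ∈ s, c i ^ 2 + e ^ 2) / 2)`.
The costs depend on the starting point `x` only, and enter through their second moments.
Keeping the function `a` separate from `F` makes the induction on `s` close. The independence of
the coordinates in `s` is expressed by the invariance of `ρ` under resampling any of them. -/
theorem integral_exp_le_of_forall_le_add_sum {ι T : Type*} [DecidableEq ι] [MeasurableSpace T]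
    (α : Measure T) [IsProbabilityMeasure α] (ρ : Measure (ι → T)) [IsProbabilityMeasure ρ]
    (hρ : ∀ i, (α.prod ρ).map (fun p : T × (ι → T) => Function.update p.2 i p.1) = ρ)
    (s : Finset ι) (F a : (ι → T) → ℝ) (c : ι → (ι → T) → ℝ) (e : (ι → T) → ℝ) (K : ℝ)
    (hF : Measurable F) (ha : Measurable a) (hc : ∀ i, Measurable (c i)) (he : Measurable e)
    (hFK : ∀ x, |F x| ≤ K) (haK : ∀ x, |a x| ≤ K) (hc0 : ∀ i x, 0 ≤ c i x)
    (hcK : ∀ i x, c i x ≤ K) (he0 : ∀ x, 0 ≤ e x) (heK : ∀ x, e x ≤ K)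
    (h1 : ∀ x x' : ι → T, (∀ i, i ∉ s → x i = x' i) →
      F x' ≤ a x + ∑ i ∈ s, {y : ι → T | y i ≠ x i}.indicator (fun _ => c i x) x')
    (h2 : ∀ x x' : ι → T,
      F x' ≤ a x + ∑ i ∈ s, {y : ι → T | y i ≠ x i}.indicator (fun _ => c i x) x' + e x) :
    ∫ x, Real.exp (F x) ∂ρ ≤
      Real.exp (∫ x, (a x + (∑ i ∈ s, c i x ^ 2 + e x ^ 2) / 2) ∂ρ) := by
  induction s using Finset.induction_on generalizing F a c e K with
  | empty =>
    simp only [Finset.sum_empty, add_zero, zero_add] at h1 h2 ⊢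
    exact integral_le_exp_integral_of_forall_le ρ ha he (fun _ => (Real.exp_pos _).le)
      haK he0 heK (fun x => Real.exp_le_exp.2 (h1 x x fun _ _ => rfl))
      fun x x' => Real.exp_le_exp.2 (h2 x x')
  | insert i s hi ih =>
    have hup : Measurable fun p : T × (ι → T) => Function.update p.2 i p.1 :=
      (measurable_update' (a := i)).comp measurable_swap
    have hupt : ∀ t, Measurable fun x : ι → T => Function.update x i t := fun t =>
      hup.comp (measurable_const.prodMk measurable_id)
    have hK0 : 0 ≤ K := by
      have : Nonempty (ι → T) := ρ.nonempty_of_neZero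
      exact (abs_nonneg _).trans (hFK (Classical.arbitrary _))
    have habs : ∀ {z : ℝ}, 0 ≤ z → z ≤ K → |z| ≤ K := fun h h' => (abs_of_nonneg h).trans_le h'
    have hsq : ∀ {z : ℝ}, 0 ≤ z → z ≤ K → |z ^ 2| ≤ K ^ 2 := fun h h' => by
      rw [abs_of_nonneg (sq_nonneg _)]; exact pow_le_pow_left₀ h h' 2
    -- Integration against `ρ` is integration over the resampled coordinate and the rest.
    have hfub : ∀ {g : (ι → T) → ℝ}, Measurable g → (∃ L, ∀ x, |g x| ≤ L) →
        ∫ x, g x ∂ρ = ∫ t, ∫ x, g (Function.update x i t) ∂ρ ∂α := by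
      rintro g hg ⟨L, hL⟩
      conv_lhs => rw [← hρ i]
      rw [integral_map hup.aemeasurable hg.aestronglyMeasurable,
        integral_prod (fun p : T × (ι → T) => g (Function.update p.2 i p.1))
        (.of_measurable_of_abs_le (hg.comp hup) (K := L) fun _ => hL _)]
    have hmeas : ∀ {g : (ι → T) → ℝ}, Measurable g →
        Measurable fun t => ∫ x, g (Function.update x i t) ∂ρ := fun hg =>
      ((hg.comp hup).stronglyMeasurable.integral_prod_right' (ν := ρ)).measurable
    let G : (ι → T) → ℝ := fun x => a x + (∑ i ∈ s, c i x ^ 2 + e x ^ 2) / 2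
    have hG : Measurable G := by fun_prop
    obtain ⟨L, hKL, hGL⟩ : ∃ L, K ≤ L ∧ ∀ x, |G x| ≤ L := by
      refine ⟨K + (s.card * K ^ 2 + K ^ 2) / 2, by
        have : (0 : ℝ) ≤ (s.card * K ^ 2 + K ^ 2) / 2 := by positivity
        linarith, fun x => (abs_add_le _ _).trans (add_le_add (haK x) ?_)⟩
      have h0 : 0 ≤ ∑ i ∈ s, c i x ^ 2 + e x ^ 2 :=
        add_nonneg (Finset.sum_nonneg fun _ _ => sq_nonneg _) (sq_nonneg _)
      rw [abs_of_nonneg (by positivity)]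
      have h3 : ∑ i ∈ s, c i x ^ 2 ≤ s.card * K ^ 2 := by
        rw [← nsmul_eq_mul]
        exact Finset.sum_le_card_nsmul _ _ _ fun k _ => pow_le_pow_left₀ (hc0 k x) (hcK k x) 2
      have h4 := pow_le_pow_left₀ (he0 x) (heK x) 2
      linarith
    -- The induction hypothesis, for the sections of `F` at `t'` and of `a`, `c`, `e` at `t`.
    have key : ∀ (t t' : T) (δ : ℝ), 0 ≤ δ → δ ≤ 1 → (t' ≠ t → 1 ≤ δ) →
        ∫ x, Real.exp (F (Function.update x i t')) ∂ρ ≤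
          Real.exp (∫ x, G (Function.update x i t) ∂ρ +
            δ * ∫ x, c i (Function.update x i t) ∂ρ) := by
      intro t t' δ hδ0 hδ1 hδ
      have hind : ∀ x x' : ι → T, ∑ k ∈ insert i s,
          {y : ι → T | y k ≠ Function.update x i t k}.indicator
            (fun _ => c k (Function.update x i t)) (Function.update x' i t') ≤
          δ * c i (Function.update x i t) + ∑ k ∈ s, {y : ι → T | y k ≠ x k}.indicator
            (fun _ => c k (Function.update x i t)) x' := by
        intro x x'
        rw [Finset.sum_insert hi]
        refine add_le_add ?_ (Finset.sum_le_sum fun k hk => ?_)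
        · by_cases h : t' = t
          · simpa [h] using mul_nonneg hδ0 (hc0 _ _)
          · simpa [h] using le_mul_of_one_le_left (hc0 _ _) (hδ h)
        · have hki : k ≠ i := fun h => hi (h ▸ hk)
          by_cases h : x' k = x k <;> simp [hki, h]
      have h := ih (fun x => F (Function.update x i t'))
        (fun x => a (Function.update x i t) + δ * c i (Function.update x i t))
        (fun k x => c k (Function.update x i t)) (fun x => e (Function.update x i t)) (K + K)
        (hF.comp (hupt t')) ((ha.comp (hupt t)).add (((hc i).comp (hupt t)).const_mul δ))
        (fun k => (hc k).comp (hupt t)) (he.comp (hupt t))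
        (fun x => (hFK _).trans (by linarith))
        (fun x => (abs_add_le _ _).trans (add_le_add (haK _) (habs (mul_nonneg hδ0 (hc0 _ _))
          ((mul_le_of_le_one_left (hc0 _ _) hδ1).trans (hcK _ _)))))
        (fun k x => hc0 _ _) (fun k x => (hcK _ _).trans (by linarith)) (fun x => he0 _)
        (fun x => (heK _).trans (by linarith))
        (fun x x' hx => by
          have := h1 (Function.update x i t) (Function.update x' i t') (fun k hk => by
            rw [Finset.mem_insert, not_or] at hk
            simp [hk.1, hx k hk.2])
          have := hind x x'
          linarith)
        (fun x x' => by
          have := h2 (Function.update x i t) (Function.update x' i t')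
          have := hind x x'
          linarith)
      refine h.trans_eq ?_
      rw [← integral_const_mul, ← integral_add]
      · congr 1
        refine integral_congr_ae (.of_forall fun x => ?_)
        simp only [G]
        ring
      · exact .of_measurable_of_abs_le (hG.comp (hupt t)) fun _ => hGL _
      · exact (Integrable.of_measurable_of_abs_le ((hc i).comp (hupt t))
          fun _ => habs (hc0 _ _) (hcK _ _)).const_mul δ
    have hCsq : ∀ t, (∫ x, c i (Function.update x i t) ∂ρ) ^ 2 ≤
        ∫ x, c i (Function.update x i t) ^ 2 ∂ρ := fun t =>
      sq_integral_le_integral_sq ρ ((hc i).comp (hupt t)) fun _ => habs (hc0 _ _) (hcK _ _)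
    have hGi : Integrable (fun t => ∫ x, G (Function.update x i t) ∂ρ) α :=
      .of_measurable_of_abs_le (hmeas hG) fun t => abs_integral_le_of_forall_abs_le ρ fun _ => hGL _
    calc ∫ x, Real.exp (F x) ∂ρ
        = ∫ t, ∫ x, Real.exp (F (Function.update x i t)) ∂ρ ∂α :=
          hfub (by fun_prop) ⟨Real.exp K, fun x => by
            rw [Real.abs_exp]; exact Real.exp_le_exp.2 ((le_abs_self _).trans (hFK x))⟩
      _ ≤ Real.exp (∫ t, (∫ x, G (Function.update x i t) ∂ρ +
            (∫ x, c i (Function.update x i t) ∂ρ) ^ 2 / 2) ∂α) :=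
          integral_le_exp_integral_of_forall_le α (K := L) (hmeas hG) (hmeas (hc i))
            (fun t => integral_nonneg fun _ => (Real.exp_pos _).le)
            (fun t => abs_integral_le_of_forall_abs_le ρ fun _ => hGL _)
            (fun t => integral_nonneg fun _ => hc0 _ _)
            (fun t => (le_abs_self _).trans (abs_integral_le_of_forall_abs_le ρ fun _ =>
              (habs (hc0 _ _) (hcK _ _)).trans hKL))
            (fun t => by simpa using key t t 0 le_rfl zero_le_one fun h => absurd rfl h)
            (fun t t' => by simpa using key t t' 1 zero_le_one le_rfl fun _ => le_rfl)
      _ ≤ Real.exp (∫ t, (∫ x, G (Function.update x i t) ∂ρ +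
            (∫ x, c i (Function.update x i t) ^ 2 ∂ρ) / 2) ∂α) := by
          refine Real.exp_le_exp.2 (integral_mono (hGi.add (.div_const
            (.of_measurable_of_abs_le ((hmeas (hc i)).pow_const 2) (K := K ^ 2) fun t => ?_) 2))
            (hGi.add (.div_const (.of_measurable_of_abs_le (hmeas ((hc i).pow_const 2))
            (K := K ^ 2) fun t => ?_) 2)) fun t => ?_)
          · rw [abs_pow]
            exact pow_le_pow_left₀ (abs_nonneg _) (abs_integral_le_of_forall_abs_le ρ fun _ =>
              habs (hc0 _ _) (hcK _ _)) 2
          · exact abs_integral_le_of_forall_abs_le ρ fun _ => hsq (hc0 _ _) (hcK _ _)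
          · have := hCsq t
            simp only
            linarith
      _ = Real.exp (∫ x, (G x + c i x ^ 2 / 2) ∂ρ) := by
          congr 1
          rw [hfub (g := fun x => G x + c i x ^ 2 / 2) (by fun_prop) ⟨L + K ^ 2 / 2, fun x => ?_⟩]
          · refine integral_congr_ae (.of_forall fun t => ?_)
            simp only
            rw [integral_add (f := fun x => G (Function.update x i t)), integral_div]
            · exact .of_measurable_of_abs_le (hG.comp (hupt t)) fun _ => hGL _
            · exact .div_const (.of_measurable_of_abs_le (((hc i).comp (hupt t)).pow_const 2)
                fun _ => hsq (hc0 _ _) (hcK _ _)) 2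
          · refine (abs_add_le _ _).trans (add_le_add (hGL x) ?_)
            rw [abs_div, abs_two]
            have := hsq (hc0 i x) (hcK i x)
            linarith
      _ = _ := by
          congr 1
          refine integral_congr_ae (.of_forall fun x => ?_)
          simp only [G, Finset.sum_insert hi]
          ring

/-! ### Independent identically distributed configurations -/

theorem map_update_prod_infinitePi {ι T : Type*} [DecidableEq ι] [MeasurableSpace T]
    (α : Measure T) [IsProbabilityMeasure α] (i : ι) :
    (α.prod (Measure.infinitePi fun _ : ι => α)).map
      (fun p : T × (ι → T) => Function.update p.2 i p.1) = Measure.infinitePi fun _ : ι => α := by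
  refine Measure.eq_infinitePi _ fun s t ht => ?_
  have hup : Measurable fun p : T × (ι → T) => Function.update p.2 i p.1 :=
    (measurable_update' (a := i)).comp measurable_swap
  rw [Measure.map_apply hup (.pi s.countable_toSet fun i _ => ht i)]
  by_cases hi : i ∈ s
  · have : (fun p : T × (ι → T) => Function.update p.2 i p.1) ⁻¹' Set.pi s t =
        t i ×ˢ Set.pi (s.erase i) t := by
      ext ⟨a, x⟩
      simp only [Set.mem_preimage, Set.mem_pi, Finset.mem_coe, Set.mem_prod, Finset.mem_erase]
      refine ⟨fun h => ⟨by simpa using h i hi, fun k hk => by simpa [hk.1] using h k hk.2⟩,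
        fun h k hk => ?_⟩
      by_cases hki : k = i
      · subst hki; simpa using h.1
      · simpa [hki] using h.2 k ⟨hki, hk⟩
    rw [this, Measure.prod_prod, Measure.infinitePi_pi _ fun i _ => ht i,
      Finset.mul_prod_erase s (fun i => α (t i)) hi]
  · have : (fun p : T × (ι → T) => Function.update p.2 i p.1) ⁻¹' Set.pi s t =
        Set.univ ×ˢ Set.pi s t := by
      ext ⟨a, x⟩
      simp only [Set.mem_preimage, Set.mem_pi, Finset.mem_coe, Set.mem_prod, Set.mem_univ,
        true_and]
      refine forall₂_congr fun k hk => ?_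
      have hki : k ≠ i := fun h => hi (h ▸ hk)
      rw [Function.update_of_ne hki]
    rw [this, Measure.prod_prod, Measure.infinitePi_pi _ fun i _ => ht i, measure_univ, one_mul]

theorem measurable_latticeShift {d : ℕ} {T : Type*} [MeasurableSpace T] (j : IntGrid d) :
    Measurable (latticeShift (A := T) j) :=
  measurable_pi_lambda _ fun i => measurable_pi_apply (i + j)

theorem measurePreserving_latticeShift {d : ℕ} {T : Type*} [MeasurableSpace T] (α : Measure T)
    [IsProbabilityMeasure α] (j : IntGrid d) :
    MeasurePreserving (latticeShift j) (Measure.infinitePi fun _ : IntGrid d => α)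
      (Measure.infinitePi fun _ : IntGrid d => α) :=
  ⟨measurable_latticeShift j, Measure.map_infinitePi_infinitePi_of_inj (add_left_injective j)⟩

theorem IsIIDField.map_fieldConfig {d : ℕ} {A Ω : Type*} [MeasurableSpace A] [MeasurableSpace Ω]
    {X : IntGrid d → Ω → A} {P : Measure Ω} (hX : IsIIDField X P) :
    P.map (fieldConfig X) = Measure.infinitePi fun _ : IntGrid d => P.map (X 0) :=
  (hX.indep.map_fun_eq_infinitePi_map hX.measurable).trans
    (congrArg _ (funext fun i => (hX.identDistrib i 0).map_eq))

/-! ### Balls of the lattice -/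

section Ball

variable {d : ℕ}

theorem linfBall_mono (j : IntGrid d) {r s : ℕ∞} (h : r ≤ s) : linfBall j r ⊆ linfBall j s :=
  fun _ hi k => (hi k).trans h

theorem linfBall_top (j : IntGrid d) : linfBall j ⊤ = Set.univ :=
  Set.eq_univ_of_forall fun _ _ => le_top

theorem add_mem_linfBall {i j : IntGrid d} {r : ℕ∞} (h : i ∈ linfBall 0 r) :
    i + j ∈ linfBall j r := fun k => by simpa using h k

theorem encard_linfBall (hd : 1 ≤ d) (j : IntGrid d) (r : ℕ∞) :
    (linfBall j r).encard = (2 * r + 1) ^ d := by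
  induction r using ENat.recTopCoe with
  | top =>
    have : Nonempty (Fin d) := ⟨⟨0, hd⟩⟩
    rw [linfBall_top, Set.encard_univ, ENat.card_eq_top_of_infinite, ENat.mul_top (by simp),
      top_add, ENat.top_pow (by omega)]
  | coe n =>
    have : linfBall j n =
        (Fintype.piFinset fun k => Finset.Icc (j k - n) (j k + n) : Finset (IntGrid d)) := by
      ext i
      simp only [linfBall, Set.mem_ofPred_eq, Nat.cast_le, Finset.mem_coe, Fintype.mem_piFinset,
        Finset.mem_Icc]
      exact forall_congr' fun k => by omega
    rw [this, Set.encard_coe_eq_coe_finsetCard, Fintype.card_piFinset]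
    have h : ∀ k, (j k + n + 1 - (j k - n)).toNat = 2 * n + 1 := fun k => by omega
    simp [h]

open Classical in
theorem card_filter_mem_linfBall_le (hd : 1 ≤ d) (s : Finset (IntGrid d)) (j : IntGrid d)
    (r : ℕ∞) : ((s.filter (· ∈ linfBall j r)).card : ℝ≥0∞) ≤ (2 * (r : ℝ≥0∞) + 1) ^ d := by
  have h : ((s.filter (· ∈ linfBall j r)).card : ℕ∞) ≤ (2 * r + 1) ^ d := by
    rw [← encard_linfBall hd j r, ← Set.encard_coe_eq_coe_finsetCard]
    exact Set.encard_le_encard fun i hi => (Finset.mem_filter.1 hi).2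
  have := ENat.toENNReal_le.2 h
  simpa using this

theorem mem_linfBall_comm {i j : IntGrid d} {r : ℕ∞} : i ∈ linfBall j r ↔ j ∈ linfBall i r :=
  forall_congr' fun k => by rw [← Int.natAbs_neg, neg_sub]

theorem mem_linfBall_add {i j k : IntGrid d} {r s : ℕ∞} (h : i ∈ linfBall j r)
    (h' : i ∈ linfBall k s) : k ∈ linfBall j (r + s) := by
  intro l
  have h1 : (k l - j l).natAbs ≤ (i l - j l).natAbs + (i l - k l).natAbs := by omega
  calc ((k l - j l).natAbs : ℕ∞) ≤ ((i l - j l).natAbs : ℕ∞) + ((i l - k l).natAbs : ℕ∞) := by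
        exact_mod_cast h1
    _ ≤ r + s := add_le_add (h l) (h' l)

open Classical in
/-- If two balls meet, then the centre of the smaller one lies in the double of the larger one. -/
theorem card_filter_mem_linfBall_inter_le (hd : 1 ≤ d) (s : Finset (IntGrid d)) (j k : IntGrid d)
    (r r' : ℕ∞) : ((s.filter fun i => i ∈ linfBall j r ∧ i ∈ linfBall k r').card : ℝ≥0∞) ≤
      (if k ∈ linfBall j (2 * r) then (2 * (r : ℝ≥0∞) + 1) ^ d else 0) +
      (if j ∈ linfBall k (2 * r') then (2 * (r' : ℝ≥0∞) + 1) ^ d else 0) := by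
  rcases (s.filter fun i => i ∈ linfBall j r ∧ i ∈ linfBall k r').eq_empty_or_nonempty with h | h
  · simp [h]
  obtain ⟨i, hi⟩ := h
  obtain ⟨hi1, hi2⟩ := (Finset.mem_filter.1 hi).2
  rcases le_total r' r with hr | hr
  · have : k ∈ linfBall j (2 * r) :=
      linfBall_mono j (by rw [two_mul]; gcongr) (mem_linfBall_add hi1 hi2)
    rw [if_pos this]
    refine le_add_right (le_trans ?_ (card_filter_mem_linfBall_le hd s j r))
    exact Nat.cast_le.2 (Finset.card_le_card fun i hi =>
      Finset.mem_filter.2 ⟨(Finset.mem_filter.1 hi).1, (Finset.mem_filter.1 hi).2.1⟩)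
  · have : j ∈ linfBall k (2 * r') :=
      linfBall_mono k (by rw [two_mul]; gcongr) (mem_linfBall_add hi2 hi1)
    rw [if_pos this]
    refine le_add_left (le_trans ?_ (card_filter_mem_linfBall_le hd s k r'))
    exact Nat.cast_le.2 (Finset.card_le_card fun i hi =>
      Finset.mem_filter.2 ⟨(Finset.mem_filter.1 hi).1, (Finset.mem_filter.1 hi).2.2⟩)

end Ball

/-! ### The coding radius -/

section CodingRadius

variable {d : ℕ} {A B : Type*} {φ : (IntGrid d → A) → (IntGrid d → B)}

theorem codingRadius_le_natCast_iff {x : IntGrid d → A} {n : ℕ} :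
    codingRadius φ x ≤ n ↔
      ∀ x' : IntGrid d → A, (∀ i ∈ linfBall (0 : IntGrid d) (n : ℕ∞), x' i = x i) →
        φ x' 0 = φ x 0 := by
  refine ⟨fun h x' hx' => ?_, fun h => iInf₂_le n h⟩
  have h' : codingRadius φ x < ((n + 1 : ℕ) : ℕ∞) :=
    h.trans_lt (by exact_mod_cast n.lt_succ_self)
  obtain ⟨r, hr⟩ := iInf_lt_iff.1 h'
  obtain ⟨hrx, hrn⟩ := iInf_lt_iff.1 hr
  have hrn : r ≤ n := Nat.lt_succ_iff.1 (by exact_mod_cast hrn)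
  exact hrx x' fun i hi => hx' i (linfBall_mono 0 (by exact_mod_cast hrn) hi)

theorem exists_mem_linfBall_ne_of_apply_zero_ne {x x' : IntGrid d → A} (h : φ x' 0 ≠ φ x 0) :
    ∃ i ∈ linfBall (0 : IntGrid d) (codingRadius φ x), x' i ≠ x i := by
  by_contra! hx
  apply h
  cases hr : codingRadius φ x using ENat.recTopCoe with
  | top =>
    rw [hr, linfBall_top] at hx
    rw [funext fun i => hx i trivial]
  | coe n => exact codingRadius_le_natCast_iff.1 hr.le x' (hr ▸ hx)

/-- By stationarity, the value of an equivariant map at `j` is determined by the configuration in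
the ball around `j` whose radius is the coding radius of the shifted configuration. -/
theorem exists_mem_linfBall_ne_of_apply_ne
    (hφ : ∀ (j : IntGrid d) (x : IntGrid d → A), φ (latticeShift j x) = latticeShift j (φ x))
    {x x' : IntGrid d → A} {j : IntGrid d} (h : φ x' j ≠ φ x j) :
    ∃ i ∈ linfBall j (codingRadius φ (latticeShift j x)), x' i ≠ x i := by
  have h0 : ∀ x, φ (latticeShift j x) 0 = φ x j := fun x => by
    rw [hφ, latticeShift, zero_add]
  obtain ⟨i, hi, hne⟩ := exists_mem_linfBall_ne_of_apply_zero_ne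
    (φ := φ) (x := latticeShift j x)
    (x' := latticeShift j x') (by rwa [h0, h0])
  exact ⟨i + j, add_mem_linfBall hi, hne⟩

/-- The sublevel sets of the coding radius are coanalytic, hence universally measurable. -/
theorem aemeasurable_codingRadius [MeasurableSpace A] [StandardBorelSpace A] [MeasurableSpace B]
    [StandardBorelSpace B] (hφ : Measurable φ) (μ : Measure (IntGrid d → A)) [IsFiniteMeasure μ] :
    AEMeasurable (codingRadius φ) μ := by
  refine aemeasurable_enat_of_nullMeasurableSet_le fun n => ?_
  let s : Set ((IntGrid d → A) × (IntGrid d → A)) :=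
    {p | (∀ i ∈ linfBall (0 : IntGrid d) (n : ℕ∞), p.2 i = p.1 i) ∧ φ p.2 0 ≠ φ p.1 0}
  have h1 : MeasurableSet
      {p : (IntGrid d → A) × (IntGrid d → A) |
        ∀ i ∈ linfBall (0 : IntGrid d) (n : ℕ∞), p.2 i = p.1 i} := by
    refine .congr (.biInter (Set.to_countable (linfBall (0 : IntGrid d) (n : ℕ∞))) fun i _ =>
      measurableSet_eq_fun (f := fun p : (IntGrid d → A) × (IntGrid d → A) => p.2 i)
        (g := fun p => p.1 i) (by fun_prop) (by fun_prop)) ?_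
    ext p
    simp
  have h2 : MeasurableSet {p : (IntGrid d → A) × (IntGrid d → A) | φ p.2 0 = φ p.1 0} :=
    measurableSet_eq_fun ((measurable_pi_apply 0).comp (hφ.comp measurable_snd))
      ((measurable_pi_apply 0).comp (hφ.comp measurable_fst))
  have hs : MeasurableSet s := h1.inter h2.compl
  convert (hs.nullMeasurableSet_image_fst μ).compl using 1
  ext x
  simp [s, codingRadius_le_natCast_iff]

end CodingRadius

/-! ### Oscillations -/

section Oscillation

variable {d : ℕ} {B : Type*} {f : (IntGrid d → B) → ℝ}

theorem abs_sub_le_osc (hf : HasBoundedDifferences f) {j : IntGrid d} {y y' : IntGrid d → B}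
    (h : ∀ l, l ≠ j → y l = y' l) : |f y - f y'| ≤ (osc f j).toReal := by
  rw [← ENNReal.ofReal_le_iff_le_toReal (hf j).ne]
  exact le_iSup_of_le y (le_iSup_of_le y' (le_iSup_of_le h le_rfl))

open Classical in
theorem abs_sub_piecewise_le (hf : HasBoundedDifferences f) (y y' : IntGrid d → B)
    (s : Finset (IntGrid d)) :
    |f (s.piecewise y' y) - f y| ≤ ∑ j ∈ s, if y' j = y j then 0 else (osc f j).toReal := by
  induction s using Finset.induction_on with
  | empty => simp
  | insert j s hj ih =>
    rw [Finset.sum_insert hj]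
    refine (abs_sub_le _ (f (s.piecewise y' y)) _).trans (add_le_add ?_ ih)
    rw [Finset.piecewise_insert]
    split_ifs with h
    · rw [h, ← Finset.piecewise_eq_of_notMem s y' y hj, Function.update_eq_self]
      simp
    · exact abs_sub_le_osc hf fun l hl => Function.update_of_ne hl _ _

open Classical in
/-- Changing `y` to `y'` one site at a time bounds the increment of `f` by a sum of oscillations;
continuity disposes of the sites where the oscillation vanishes. -/
theorem abs_sub_le_sum_osc [TopologicalSpace B] (hfc : Continuous f)
    (hfl : (dependenceSet f).Finite) (hf : HasBoundedDifferences f) (y y' : IntGrid d → B) :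
    |f y' - f y| ≤ ∑ j ∈ hfl.toFinset, if y' j = y j then 0 else (osc f j).toReal := by
  have hlim : Filter.Tendsto (fun s : Finset (IntGrid d) => |f (s.piecewise y' y) - f y|)
      Filter.atTop (nhds |f y' - f y|) := by
    refine Filter.Tendsto.abs (Filter.Tendsto.sub_const ((hfc.tendsto y').comp ?_) _)
    refine tendsto_pi_nhds.2 fun j => tendsto_const_nhds.congr' ?_
    filter_upwards [Filter.eventually_ge_atTop {j}] with s hs
    rw [Finset.piecewise_eq_of_mem _ _ _ (hs (Finset.mem_singleton_self j))]
  refine le_of_tendsto' hlim fun s => (abs_sub_piecewise_le hf y y' s).trans ?_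
  refine (Finset.sum_le_sum_of_subset_of_nonneg (Finset.subset_union_left (s₂ := hfl.toFinset))
    fun j _ _ => by split_ifs <;> positivity).trans_eq
      (Finset.sum_subset Finset.subset_union_right fun j _ hj => ?_).symm
  have : osc f j = 0 := by
    simpa [dependenceSet] using hj
  simp [this]

theorem oscNorm_two_toReal_sq (hfl : (dependenceSet f).Finite) (hf : HasBoundedDifferences f) :
    (oscNorm f 2).toReal ^ 2 = ∑ j ∈ hfl.toFinset, (osc f j).toReal ^ 2 := by
  have h : ∑' j, osc f j ^ 2 = ∑ j ∈ hfl.toFinset, osc f j ^ 2 := by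
    refine tsum_eq_sum fun j hj => ?_
    have : osc f j = 0 := by simpa [dependenceSet] using hj
    simp [this]
  rw [oscNorm, ← ENNReal.toReal_pow, ← ENNReal.rpow_natCast, ← ENNReal.rpow_mul, h]
  simp only [Nat.cast_ofNat, one_div, ne_eq, OfNat.ofNat_ne_zero, not_false_eq_true,
    inv_mul_cancel₀, ENNReal.rpow_one]
  rw [ENNReal.toReal_sum fun j _ => ENNReal.pow_ne_top (hf j).ne]
  simp

end Oscillation

/-! ### The second moment of the costs -/

section SecondMoment

variable {d : ℕ} {T : Type*} [MeasurableSpace T]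

theorem measurableSet_mem_linfBall {α : Type*} [MeasurableSpace α] {R : α → ℕ∞}
    (hR : Measurable R) (i j : IntGrid d) : MeasurableSet {x | i ∈ linfBall j (R x)} := by
  have : MeasurableSet {r : ℕ∞ | i ∈ linfBall j r} := .of_discrete
  exact hR this

open Classical in
theorem sum_sq_sum_eq_sum_mul_card {ι κ : Type*} (s : Finset ι) (Λ : Finset κ) (D : κ → ℝ≥0∞)
    (U : κ → Set ι) :
    ∑ i ∈ s, (∑ j ∈ Λ, if i ∈ U j then D j else 0) ^ 2 =
      ∑ j ∈ Λ, ∑ k ∈ Λ, D j * D k * ((s.filter fun i => i ∈ U j ∧ i ∈ U k).card : ℝ≥0∞) := by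
  simp_rw [sq, Finset.sum_mul_sum]
  rw [Finset.sum_comm]
  refine Finset.sum_congr rfl fun j _ => ?_
  rw [Finset.sum_comm]
  refine Finset.sum_congr rfl fun k _ => ?_
  rw [Finset.card_filter, Nat.cast_sum, Finset.mul_sum]
  refine Finset.sum_congr rfl fun i _ => ?_
  by_cases h : i ∈ U j <;> by_cases h' : i ∈ U k <;> simp [h, h']

theorem two_mul_mul_le_sq_add_sq_ennreal {a b : ℝ≥0∞} (ha : a ≠ ⊤) (hb : b ≠ ⊤) :
    2 * (a * b) ≤ a ^ 2 + b ^ 2 := by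
  lift a to NNReal using ha
  lift b to NNReal using hb
  have := two_mul_le_add_sq a b
  rw [mul_assoc] at this
  exact_mod_cast this

open Classical in
/-- The second moment of the random cost vector `i ↦ ∑ j ∈ Λ, D j 1[i ∈ B(j, R_j)]`, where
`R_j = R ∘ T^j` is a stationary field of radii. Expanding the square produces the cardinalities of
the pairwise intersections of the balls, and each is charged to the larger of the two balls. -/
theorem lintegral_sum_sq_le (hd : 1 ≤ d) (ρ : Measure (IntGrid d → T))
    (hρ : ∀ j, MeasurePreserving (latticeShift j) ρ ρ) {R : (IntGrid d → T) → ℕ∞}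
    (hR : Measurable R) (s Λ : Finset (IntGrid d)) (D : IntGrid d → ℝ≥0∞) (hD : ∀ j, D j ≠ ⊤) :
    ∫⁻ x, ∑ i ∈ s, (∑ j ∈ Λ, if i ∈ linfBall j (R (latticeShift j x)) then D j else 0) ^ 2 ∂ρ ≤
      2 * 2 ^ d * (∫⁻ x, (2 * (R x : ℝ≥0∞) + 1) ^ (2 * d) ∂ρ) * ∑ j ∈ Λ, D j ^ 2 := by
  let c : ℕ∞ → ℝ≥0∞ := fun r => (2 * (r : ℝ≥0∞) + 1) ^ d
  have hRm : ∀ g : ℕ∞ → ℝ≥0∞, Measurable fun x => g (R x) := fun g =>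
    (Measurable.of_discrete (f := g)).comp hR
  -- `M j k x` is the volume of the ball at `j` if its double contains `k`, and zero otherwise.
  let M : IntGrid d → IntGrid d → (IntGrid d → T) → ℝ≥0∞ := fun j k x =>
    if k ∈ linfBall j (2 * R (latticeShift j x)) then c (R (latticeShift j x)) else 0
  have hM : ∀ j k, Measurable (M j k) := fun j k =>
    (hRm fun r => if k ∈ linfBall j (2 * r) then c r else 0).comp (measurable_latticeShift j)
  let m : ℝ≥0∞ := ∫⁻ x, (2 * (R x : ℝ≥0∞) + 1) ^ (2 * d) ∂ρ
  have hdbl : ∀ (r : ℕ∞) (j : IntGrid d), c r * (Λ.filter (· ∈ linfBall j (2 * r))).card ≤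
      2 ^ d * (2 * (r : ℝ≥0∞) + 1) ^ (2 * d) := by
    intro r j
    calc c r * (Λ.filter (· ∈ linfBall j (2 * r))).card
        ≤ (2 * (r : ℝ≥0∞) + 1) ^ d * (2 * (2 * (r : ℝ≥0∞) + 1)) ^ d := by
          refine mul_le_mul_right ((card_filter_mem_linfBall_le hd Λ j _).trans ?_) _
          gcongr
          rw [ENat.toENNReal_mul, mul_add]
          gcongr <;> norm_num
      _ = _ := by rw [mul_pow, two_mul d, pow_add]; ring
  have hMj : ∀ j, ∫⁻ x, ∑ k ∈ Λ, M j k x ∂ρ ≤ 2 ^ d * m := by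
    intro j
    calc ∫⁻ x, ∑ k ∈ Λ, M j k x ∂ρ
        ≤ ∫⁻ x, 2 ^ d * (2 * (R (latticeShift j x) : ℝ≥0∞) + 1) ^ (2 * d) ∂ρ := by
          refine lintegral_mono fun x => ?_
          simp only [M]
          rw [← Finset.sum_filter, Finset.sum_const, nsmul_eq_mul, mul_comm]
          exact hdbl _ j
      _ = ∫⁻ x, 2 ^ d * (2 * (R x : ℝ≥0∞) + 1) ^ (2 * d) ∂ρ :=
          (hρ j).lintegral_comp (f := fun x => 2 ^ d * (2 * (R x : ℝ≥0∞) + 1) ^ (2 * d))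
            (hRm fun r => 2 ^ d * (2 * (r : ℝ≥0∞) + 1) ^ (2 * d))
      _ = 2 ^ d * m := by
          rw [lintegral_const_mul _ (hRm fun r => (2 * (r : ℝ≥0∞) + 1) ^ (2 * d))]
  have hMk : ∀ k, ∑ j ∈ Λ, ∫⁻ x, M j k x ∂ρ ≤ 2 ^ d * m := by
    intro k
    -- By stationarity the balls at the various `j` may be given the same radius `R x`.
    have hst : ∀ j, ∫⁻ x, M j k x ∂ρ =
        ∫⁻ x, (if k ∈ linfBall j (2 * R x) then c (R x) else 0) ∂ρ := fun j =>
      (hρ j).lintegral_comp (f := fun x => if k ∈ linfBall j (2 * R x) then c (R x) else 0)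
        (hRm fun r => if k ∈ linfBall j (2 * r) then c r else 0)
    simp_rw [hst]
    rw [← lintegral_finsetSum _ fun j _ => hRm fun r => if k ∈ linfBall j (2 * r) then c r else 0,
      ← lintegral_const_mul _ (hRm fun r => (2 * (r : ℝ≥0∞) + 1) ^ (2 * d))]
    refine lintegral_mono fun x => ?_
    simp only [mem_linfBall_comm (i := k)]
    rw [← Finset.sum_filter, Finset.sum_const, nsmul_eq_mul, mul_comm]
    exact hdbl _ k
  calc ∫⁻ x, ∑ i ∈ s, (∑ j ∈ Λ, if i ∈ linfBall j (R (latticeShift j x)) then D j else 0) ^ 2 ∂ρ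
      ≤ ∫⁻ x, ∑ j ∈ Λ, ∑ k ∈ Λ, (D j ^ 2 + D k ^ 2) * M j k x ∂ρ := by
        refine lintegral_mono fun x => ?_
        simp only
        rw [sum_sq_sum_eq_sum_mul_card s Λ D fun j => linfBall j (R (latticeShift j x))]
        calc _ ≤ ∑ j ∈ Λ, ∑ k ∈ Λ, D j * D k * (M j k x + M k j x) := by
              gcongr with j _ k _
              exact card_filter_mem_linfBall_inter_le hd s j k _ _
          _ = ∑ j ∈ Λ, ∑ k ∈ Λ, 2 * (D j * D k) * M j k x := by
              simp_rw [mul_add, Finset.sum_add_distrib]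
              rw [Finset.sum_comm (f := fun j k => D j * D k * M k j x), ← Finset.sum_add_distrib]
              refine Finset.sum_congr rfl fun j _ => ?_
              rw [← Finset.sum_add_distrib]
              exact Finset.sum_congr rfl fun k _ => by ring
          _ ≤ _ := by
              gcongr with j _ k _
              exact two_mul_mul_le_sq_add_sq_ennreal (hD j) (hD k)
    _ = ∑ j ∈ Λ, D j ^ 2 * ∫⁻ x, ∑ k ∈ Λ, M j k x ∂ρ +
          ∑ k ∈ Λ, D k ^ 2 * ∑ j ∈ Λ, ∫⁻ x, M j k x ∂ρ := by
        rw [lintegral_finsetSum _ fun j _ => Finset.measurable_fun_sum _ fun k _ =>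
          (hM j k).const_mul _]
        have h : ∀ j, ∫⁻ x, ∑ k ∈ Λ, (D j ^ 2 + D k ^ 2) * M j k x ∂ρ =
            ∑ k ∈ Λ, (D j ^ 2 + D k ^ 2) * ∫⁻ x, M j k x ∂ρ := fun j => by
          rw [lintegral_finsetSum _ fun k _ => (hM j k).const_mul _]
          exact Finset.sum_congr rfl fun k _ => lintegral_const_mul _ (hM j k)
        simp_rw [h, add_mul, Finset.sum_add_distrib]
        congr 1
        · refine Finset.sum_congr rfl fun j _ => ?_
          rw [lintegral_finsetSum _ fun k _ => hM j k, Finset.mul_sum]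
        · rw [Finset.sum_comm]
          exact Finset.sum_congr rfl fun k _ => by rw [Finset.mul_sum]
    _ ≤ ∑ j ∈ Λ, D j ^ 2 * (2 ^ d * m) + ∑ k ∈ Λ, D k ^ 2 * (2 ^ d * m) := by
        gcongr with j _ k _
        · exact hMj j
        · exact hMk k
    _ = 2 * 2 ^ d * m * ∑ j ∈ Λ, D j ^ 2 := by rw [← Finset.sum_mul]; ring

end SecondMoment

/-! ### Concentration for coded configurations -/

theorem abs_le_abs_add_sum_osc {d : ℕ} {B : Type*} {f : (IntGrid d → B) → ℝ} [TopologicalSpace B]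
    (hfc : Continuous f) (hfl : (dependenceSet f).Finite) (hf : HasBoundedDifferences f)
    (y₀ y : IntGrid d → B) : |f y| ≤ |f y₀| + ∑ j ∈ hfl.toFinset, (osc f j).toReal := by
  classical
  have h1 := abs_sub_le_sum_osc hfc hfl hf y₀ y
  have h2 : ∑ j ∈ hfl.toFinset, (if y j = y₀ j then 0 else (osc f j).toReal) ≤
      ∑ j ∈ hfl.toFinset, (osc f j).toReal :=
    Finset.sum_le_sum fun j _ => by split_ifs <;> simp
  have h3 := abs_add_le (f y₀) (f y - f y₀)
  rw [add_sub_cancel] at h3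
  linarith

open Classical in
/-- Concentration for a local function `f` of a coded i.i.d. configuration, for a measurable field
of radii `R ∘ T^j` that control the dependence of `φ` at the sites `j`. The sites outside a finite
set `s` are treated as a single coordinate, whose cost vanishes as `s` exhausts the lattice. -/
theorem integral_exp_comp_le {d : ℕ} (hd : 1 ≤ d) {A B : Type*} [MeasurableSpace A]
    [MeasurableSpace B] [TopologicalSpace B] (α : Measure A) [IsProbabilityMeasure α]
    {φ : (IntGrid d → A) → (IntGrid d → B)} (hφ : Measurable φ) {R : (IntGrid d → A) → ℕ∞}
    (hR : Measurable R)
    (hRφ : ∀ x x' j, φ x' j ≠ φ x j → ∃ i ∈ linfBall j (R (latticeShift j x)), x' i ≠ x i)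
    (hRfin : ∀ᵐ x ∂Measure.infinitePi fun _ : IntGrid d => α, R x < ⊤)
    (hRm : ∫⁻ x, (2 * (R x : ℝ≥0∞) + 1) ^ (2 * d) ∂(Measure.infinitePi fun _ : IntGrid d => α) ≠ ⊤)
    {f : (IntGrid d → B) → ℝ} (hfm : Measurable f) (hfc : Continuous f)
    (hfl : (dependenceSet f).Finite) (hf : HasBoundedDifferences f) {lam : ℝ} (hlam : 0 < lam) :
    ∫ x, Real.exp (lam * f (φ x)) ∂(Measure.infinitePi fun _ : IntGrid d => α) ≤
      Real.exp (lam * ∫ x, f (φ x) ∂(Measure.infinitePi fun _ : IntGrid d => α) +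
        2 ^ d * lam ^ 2 * (∫⁻ x, (2 * (R x : ℝ≥0∞) + 1) ^ (2 * d)
          ∂(Measure.infinitePi fun _ : IntGrid d => α)).toReal *
          ∑ j ∈ hfl.toFinset, (osc f j).toReal ^ 2) := by
  set ρ : Measure (IntGrid d → A) := Measure.infinitePi fun _ : IntGrid d => α
  set m : ℝ≥0∞ := ∫⁻ x, (2 * (R x : ℝ≥0∞) + 1) ^ (2 * d) ∂ρ
  set Λ := hfl.toFinset
  set D : IntGrid d → ℝ := fun j => (osc f j).toReal with hD
  have hD0 : ∀ j, 0 ≤ D j := fun j => ENNReal.toReal_nonneg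
  have hshift : ∀ j, MeasurePreserving (latticeShift j) ρ ρ := measurePreserving_latticeShift α
  have hRj : ∀ j, Measurable fun x => R (latticeShift j x) := fun j =>
    hR.comp (measurable_latticeShift j)
  -- The cost of changing the site `i`: the oscillations at the sites whose value may be affected.
  let c : IntGrid d → (IntGrid d → A) → ℝ := fun i x =>
    lam * ∑ j ∈ Λ, if i ∈ linfBall j (R (latticeShift j x)) then D j else 0
  -- The cost of changing anything outside `s`.
  let e : Finset (IntGrid d) → (IntGrid d → A) → ℝ := fun s x =>
    lam * ∑ j ∈ Λ, if linfBall j (R (latticeShift j x)) ⊆ (s : Set (IntGrid d)) then 0 else D j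
  obtain ⟨x₀⟩ : Nonempty (IntGrid d → A) := ρ.nonempty_of_neZero
  let L : ℝ := |f (φ x₀)| + ∑ j ∈ Λ, D j
  have hfL : ∀ x, |f (φ x)| ≤ L := fun x => abs_le_abs_add_sum_osc hfc hfl hf _ _
  have hDL : ∑ j ∈ Λ, D j ≤ L := le_add_of_nonneg_left (abs_nonneg _)
  have hFm : Measurable fun x => lam * f (φ x) := (hfm.comp hφ).const_mul lam
  have hFL : ∀ x, |lam * f (φ x)| ≤ lam * L := fun x => by
    rw [abs_mul, abs_of_pos hlam]; exact mul_le_mul_of_nonneg_left (hfL x) hlam.le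
  have hcm : ∀ i, Measurable (c i) := fun i => .const_mul (Finset.measurable_fun_sum _ fun j _ =>
    .ite (measurableSet_mem_linfBall (hRj j) i j) measurable_const measurable_const) _
  have hem : ∀ s, Measurable (e s) := fun s => by
    refine .const_mul (Finset.measurable_fun_sum _ fun j _ => ?_) _
    exact (Measurable.of_discrete (f := fun r : ℕ∞ =>
      if linfBall j r ⊆ (s : Set (IntGrid d)) then 0 else D j)).comp (hRj j)
  have hc0 : ∀ i x, 0 ≤ c i x := fun i x => mul_nonneg hlam.le
    (Finset.sum_nonneg fun j _ => by split_ifs <;> simp [hD0])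
  have he0 : ∀ s x, 0 ≤ e s x := fun s x => mul_nonneg hlam.le
    (Finset.sum_nonneg fun j _ => by split_ifs <;> simp [hD0])
  have hcL : ∀ i x, c i x ≤ lam * L := fun i x => mul_le_mul_of_nonneg_left
    ((Finset.sum_le_sum fun j _ => by split_ifs <;> simp [hD0]).trans hDL) hlam.le
  have heL : ∀ s x, e s x ≤ lam * L := fun s x => mul_le_mul_of_nonneg_left
    ((Finset.sum_le_sum fun j _ => by split_ifs <;> simp [hD0]).trans hDL) hlam.le
  have habs : ∀ {z : ℝ}, 0 ≤ z → z ≤ lam * L → |z ^ 2| ≤ (lam * L) ^ 2 := fun h h' => by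
    rw [abs_of_nonneg (sq_nonneg _)]; exact pow_le_pow_left₀ h h' 2
  -- Each discrepancy between `φ x` and `φ x'` is paid for by a discrepancy between `x` and `x'`.
  have hinc : ∀ x x', lam * f (φ x') ≤
      lam * f (φ x) + lam * ∑ j ∈ Λ, if φ x' j = φ x j then 0 else D j := fun x x' => by
    rw [← mul_add]
    have := (le_abs_self _).trans (abs_sub_le_sum_osc hfc hfl hf (φ x) (φ x'))
    exact mul_le_mul_of_nonneg_left (by linarith) hlam.le
  have hsum : ∀ (s : Finset (IntGrid d)) (x x' : IntGrid d → A),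
      ∑ i ∈ s, {y : IntGrid d → A | y i ≠ x i}.indicator (fun _ => c i x) x' =
        lam * ∑ j ∈ Λ, ∑ i ∈ s, if i ∈ linfBall j (R (latticeShift j x)) ∧ x' i ≠ x i
          then D j else 0 := by
    intro s x x'
    rw [Finset.sum_comm, Finset.mul_sum]
    refine Finset.sum_congr rfl fun i _ => ?_
    by_cases h : x' i = x i <;> simp [h, c]
  have hsite : ∀ (s : Finset (IntGrid d)) (x x' : IntGrid d → A) (j i : IntGrid d), i ∈ s →
      i ∈ linfBall j (R (latticeShift j x)) → x' i ≠ x i →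
      D j ≤ ∑ i ∈ s, if i ∈ linfBall j (R (latticeShift j x)) ∧ x' i ≠ x i then D j else 0 := by
    intro s x x' j i his hi hne
    refine le_trans ?_ (Finset.single_le_sum (fun i _ => by split_ifs <;> simp [hD0]) his)
    rw [if_pos ⟨hi, hne⟩]
  have h1 : ∀ (s : Finset (IntGrid d)) (x x' : IntGrid d → A), (∀ i, i ∉ s → x i = x' i) →
      lam * f (φ x') ≤ lam * f (φ x) +
        ∑ i ∈ s, {y : IntGrid d → A | y i ≠ x i}.indicator (fun _ => c i x) x' := by
    intro s x x' hx
    refine (hinc x x').trans ?_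
    rw [hsum]
    gcongr with j _
    split_ifs with h
    · exact Finset.sum_nonneg fun i _ => by split_ifs <;> simp [hD0]
    · obtain ⟨i, hi, hne⟩ := hRφ x x' j h
      exact hsite s x x' j i (by_contra fun his => hne (hx i his).symm) hi hne
  have h2 : ∀ (s : Finset (IntGrid d)) (x x' : IntGrid d → A),
      lam * f (φ x') ≤ lam * f (φ x) +
        ∑ i ∈ s, {y : IntGrid d → A | y i ≠ x i}.indicator (fun _ => c i x) x' + e s x := by
    intro s x x'
    refine (hinc x x').trans ?_
    simp only [e]
    rw [hsum, add_assoc, ← mul_add _ (∑ j ∈ Λ, _), ← Finset.sum_add_distrib]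
    gcongr with j _
    have hnn : 0 ≤ ∑ i ∈ s, if i ∈ linfBall j (R (latticeShift j x)) ∧ x' i ≠ x i
        then D j else 0 := Finset.sum_nonneg fun i _ => by split_ifs <;> simp [hD0]
    by_cases h : φ x' j = φ x j
    · rw [if_pos h]
      exact add_nonneg hnn (by split_ifs <;> simp [hD0])
    · rw [if_neg h]
      by_cases hs : linfBall j (R (latticeShift j x)) ⊆ (s : Set (IntGrid d))
      · obtain ⟨i, hi, hne⟩ := hRφ x x' j h
        rw [if_pos hs, add_zero]
        exact hsite s x x' j i (hs hi) hi hne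
      · rw [if_neg hs]
        exact le_add_of_nonneg_left hnn
  have hci : ∀ i, Integrable (fun x => c i x ^ 2) ρ := fun i =>
    .of_measurable_of_abs_le ((hcm i).pow_const 2) fun x => habs (hc0 i x) (hcL i x)
  have hei : ∀ s, Integrable (fun x => e s x ^ 2) ρ := fun s =>
    .of_measurable_of_abs_le ((hem s).pow_const 2) fun x => habs (he0 s x) (heL s x)
  let V : ℝ := 2 * 2 ^ d * m.toReal * ∑ j ∈ Λ, D j ^ 2
  have hV0 : 0 ≤ V := by positivity
  have hcV : ∀ s : Finset (IntGrid d), ∫ x, ∑ i ∈ s, c i x ^ 2 ∂ρ ≤ lam ^ 2 * V := by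
    intro s
    have h := lintegral_sum_sq_le hd ρ hshift hR s Λ (osc f) fun j => (hf j).ne
    rw [integral_eq_lintegral_of_nonneg_ae
      (.of_forall fun x => Finset.sum_nonneg fun i _ => sq_nonneg _)
      (Finset.measurable_fun_sum _ fun i _ => (hcm i).pow_const 2).aestronglyMeasurable]
    refine ENNReal.toReal_le_of_le_ofReal (by positivity) ?_
    have hpt : ∀ x, ENNReal.ofReal (∑ i ∈ s, c i x ^ 2) = ENNReal.ofReal (lam ^ 2) *
        ∑ i ∈ s, (∑ j ∈ Λ, if i ∈ linfBall j (R (latticeShift j x)) then osc f j else 0) ^ 2 := by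
      intro x
      have h3 : ∀ i, ENNReal.ofReal (c i x) = ENNReal.ofReal lam *
          ∑ j ∈ Λ, if i ∈ linfBall j (R (latticeShift j x)) then osc f j else 0 := by
        intro i
        rw [ENNReal.ofReal_mul hlam.le,
          ENNReal.ofReal_sum_of_nonneg fun j _ => by split_ifs <;> simp [hD0]]
        congr 1
        refine Finset.sum_congr rfl fun j _ => ?_
        split_ifs
        · exact ENNReal.ofReal_toReal (hf j).ne
        · exact ENNReal.ofReal_zero
      rw [ENNReal.ofReal_sum_of_nonneg fun i _ => sq_nonneg _, Finset.mul_sum]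
      refine Finset.sum_congr rfl fun i _ => ?_
      rw [ENNReal.ofReal_pow (hc0 i x), h3, mul_pow, ENNReal.ofReal_pow hlam.le]
    simp_rw [hpt]
    rw [lintegral_const_mul' _ _ ENNReal.ofReal_ne_top, ENNReal.ofReal_mul (sq_nonneg _)]
    refine mul_le_mul_right (h.trans_eq ?_) _
    rw [← ENNReal.ofReal_toReal (a := 2 * 2 ^ d * m * ∑ j ∈ Λ, osc f j ^ 2)]
    · congr 1
      simp only [V, ENNReal.toReal_mul, ENNReal.toReal_pow, ENNReal.toReal_ofNat]
      rw [ENNReal.toReal_sum fun j _ => ENNReal.pow_ne_top (hf j).ne]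
      simp [hD]
    · refine ENNReal.mul_ne_top (ENNReal.mul_ne_top
        (ENNReal.mul_ne_top ENNReal.ofNat_ne_top (ENNReal.pow_ne_top ENNReal.ofNat_ne_top)) hRm) ?_
      exact ENNReal.sum_ne_top.2 fun j _ => ENNReal.pow_ne_top (hf j).ne
  have hs : ∀ s : Finset (IntGrid d), ∫ x, Real.exp (lam * f (φ x)) ∂ρ ≤
      Real.exp (lam * ∫ x, f (φ x) ∂ρ + (lam ^ 2 * V + ∫ x, e s x ^ 2 ∂ρ) / 2) := by
    intro s
    refine (integral_exp_le_of_forall_le_add_sum α ρ (map_update_prod_infinitePi α) s _ _ c (e s)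
      (lam * L) hFm hFm hcm (hem s) hFL hFL hc0 hcL (he0 s) (heL s) (h1 s) (h2 s)).trans ?_
    refine Real.exp_le_exp.2 ?_
    have hcs : Integrable (fun x => ∑ i ∈ s, c i x ^ 2) ρ := integrable_finsetSum _ fun i _ => hci i
    have hce : Integrable (fun x => (∑ i ∈ s, c i x ^ 2 + e s x ^ 2) / 2) ρ :=
      (hcs.add (hei s)).div_const 2
    rw [integral_add (.of_measurable_of_abs_le hFm hFL) hce, integral_div, integral_add hcs (hei s),
      integral_const_mul]
    have := hcV s
    linarith
  have hlim : Filter.Tendsto (fun s => ∫ x, e s x ^ 2 ∂ρ) Filter.atTop (nhds 0) := by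
    have h := tendsto_integral_filter_of_dominated_convergence (μ := ρ)
      (l := (Filter.atTop : Filter (Finset (IntGrid d)))) (F := fun s x => e s x ^ 2)
      (f := fun _ => 0) (fun _ => (lam * L) ^ 2)
      (.of_forall fun s => ((hem s).pow_const 2).aestronglyMeasurable)
      (.of_forall fun s => .of_forall fun x => habs (he0 s x) (heL s x)) (integrable_const _) ?_
    · simpa using h
    have hfin : ∀ᵐ x ∂ρ, ∀ j ∈ Λ, R (latticeShift j x) < ⊤ :=
      (Finset.eventually_all Λ).2 fun j _ => (hshift j).quasiMeasurePreserving.ae hRfin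
    filter_upwards [hfin] with x hx
    have hball : ∀ j ∈ Λ, (linfBall j (R (latticeShift j x))).Finite := by
      intro j hj
      rw [← Set.encard_lt_top_iff, encard_linfBall hd]
      have := hx j hj
      cases hr : R (latticeShift j x) using ENat.recTopCoe with
      | top => simp [hr] at this
      | coe n => exact_mod_cast ENat.natCast_lt_top ((2 * n + 1) ^ d)
    have hev : ∀ᶠ s : Finset (IntGrid d) in Filter.atTop, ∀ j ∈ Λ,
        linfBall j (R (latticeShift j x)) ⊆ (s : Set (IntGrid d)) := by
      refine (Finset.eventually_all Λ).2 fun j hj => ?_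
      filter_upwards [Filter.eventually_ge_atTop (hball j hj).toFinset] with s hs i hi
      exact hs ((hball j hj).mem_toFinset.2 hi)
    refine tendsto_const_nhds.congr' ?_
    filter_upwards [hev] with s hs
    simp only [e]
    rw [Finset.sum_eq_zero fun j hj => if_pos (hs j hj)]
    simp
  refine ge_of_tendsto' (((hlim.const_add (lam ^ 2 * V)).div_const 2).const_add
    (lam * ∫ x, f (φ x) ∂ρ)).rexp hs |>.trans_eq ?_
  congr 1
  simp only [V, D]
  ring

theorem mainTheorem1 {d : ℕ} (hd : 1 ≤ d)
    {A : Type*} [MeasurableSpace A] [StandardBorelSpace A]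
    {B : Type*} [MeasurableSpace B] [StandardBorelSpace B] [TopologicalSpace B]
    {Ω : Type*} [MeasurableSpace Ω] (P : Measure Ω) [IsProbabilityMeasure P]
    (X : IntGrid d → Ω → A) (hX : IsIIDField X P)
    (φ : (IntGrid d → A) → (IntGrid d → B))
    (hφ : IsFinitaryCoding φ (P.map (fieldConfig X)))
    (hvol : ∫⁻ ω, ((codingVolume φ (fieldConfig X ω) : ℕ∞) : ℝ≥0∞) ^ 2 ∂P < ⊤)
    (f : (IntGrid d → B) → ℝ) (hfm : Measurable f) (hfc : Continuous f)
    (hfloc : IsLocalFunction f) (hfbd : HasBoundedDifferences f)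
    (lam : ℝ) (hlam : 0 < lam) :
    Integrable (fun ω => f (φ (fieldConfig X ω))) P ∧
    Integrable (fun ω => Real.exp (lam * (f (φ (fieldConfig X ω)) -
      ∫ ω', f (φ (fieldConfig X ω')) ∂P))) P ∧
    Real.log (∫ ω, Real.exp (lam * (f (φ (fieldConfig X ω)) -
      ∫ ω', f (φ (fieldConfig X ω')) ∂P)) ∂P) ≤
      2 ^ d * lam ^ 2 *
        (∫⁻ ω, (2 * ((codingRadius φ (fieldConfig X ω) : ℕ∞) : ℝ≥0∞) + 1) ^ (2 * d) ∂P).toReal *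
        (oscNorm f 2).toReal ^ 2 := by
  have hXm : Measurable (fieldConfig X) := measurable_pi_lambda _ hX.measurable
  have hα : IsProbabilityMeasure (P.map (X 0)) :=
    Measure.isProbabilityMeasure_map (hX.measurable 0).aemeasurable
  have hfφ : Measurable fun x => f (φ x) := hfm.comp hφ.measurable
  have hYm : Measurable fun ω => f (φ (fieldConfig X ω)) := hfφ.comp hXm
  have hfl : (dependenceSet f).Finite := hfloc
  obtain ⟨ω₀⟩ : Nonempty Ω := P.nonempty_of_neZero
  have hYL := fun ω => abs_le_abs_add_sum_osc hfc hfl hfbd (φ (fieldConfig X ω₀))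
    (φ (fieldConfig X ω))
  set L : ℝ := |f (φ (fieldConfig X ω₀))| + ∑ j ∈ hfl.toFinset, (osc f j).toReal
  set E : ℝ := ∫ ω', f (φ (fieldConfig X ω')) ∂P with hE
  have hexp : Integrable (fun ω => Real.exp (lam * (f (φ (fieldConfig X ω)) - E))) P := by
    refine .of_measurable_of_abs_le (((hYm.sub_const E).const_mul lam).exp)
      (K := Real.exp (lam * (L - E))) fun ω => ?_
    rw [Real.abs_exp]
    have := (le_abs_self _).trans (hYL ω)
    gcongr
  refine ⟨.of_measurable_of_abs_le hYm hYL, hexp, ?_⟩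
  -- Replace the coding radius by a measurable version that dominates it everywhere.
  have := Measure.isProbabilityMeasure_map (μ := P) hXm.aemeasurable
  obtain ⟨R, hR, hrR, hRr⟩ :=
    (aemeasurable_codingRadius hφ.measurable (P.map (fieldConfig X))).exists_measurable_ge
  have hRP : ∀ᵐ ω ∂P, R (fieldConfig X ω) = codingRadius φ (fieldConfig X ω) :=
    ae_of_ae_map hXm.aemeasurable hRr
  have hm : ∫⁻ ω, (2 * (codingRadius φ (fieldConfig X ω) : ℝ≥0∞) + 1) ^ (2 * d) ∂P =
      ∫⁻ x, (2 * (R x : ℝ≥0∞) + 1) ^ (2 * d) ∂(P.map (fieldConfig X)) := by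
    have hg : Measurable fun x => (2 * (R x : ℝ≥0∞) + 1) ^ (2 * d) :=
      (Measurable.of_discrete (f := fun r : ℕ∞ => (2 * (r : ℝ≥0∞) + 1) ^ (2 * d))).comp hR
    rw [lintegral_map hg hXm]
    exact lintegral_congr_ae (hRP.mono fun ω h => by simp only [h])
  have hmfin : ∫⁻ x, (2 * (R x : ℝ≥0∞) + 1) ^ (2 * d) ∂(P.map (fieldConfig X)) ≠ ⊤ := by
    rw [← hm]
    refine ne_of_eq_of_ne (lintegral_congr fun ω => ?_) hvol.ne
    rw [codingVolume, encard_linfBall hd, mul_comm 2 d, pow_mul]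
    simp
  have hRfin : ∀ᵐ x ∂(P.map (fieldConfig X)), R x < ⊤ := by
    filter_upwards [hRr, hφ.radius_lt_top] with x h1 h2
    rwa [h1]
  have hRφ : ∀ x x' j, φ x' j ≠ φ x j →
      ∃ i ∈ linfBall j (R (latticeShift j x)), x' i ≠ x i := by
    intro x x' j h
    obtain ⟨i, hi, hne⟩ := exists_mem_linfBall_ne_of_apply_ne hφ.equivariant h
    exact ⟨i, linfBall_mono j (hrR _) hi, hne⟩
  rw [hX.map_fieldConfig] at hRfin hmfin hm
  have key := integral_exp_comp_le hd (P.map (X 0)) hφ.measurable hR hRφ hRfin hmfin hfm hfc hfl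
    hfbd hlam
  rw [← hX.map_fieldConfig, integral_map hXm.aemeasurable
    (hfφ.const_mul lam).exp.aestronglyMeasurable,
    integral_map hXm.aemeasurable hfφ.aestronglyMeasurable,
    hX.map_fieldConfig, ← hm, ← hE] at key
  rw [oscNorm_two_toReal_sq hfl hfbd, Real.log_le_iff_le_exp (integral_exp_pos hexp)]
  simp_rw [mul_sub, Real.exp_sub]
  rw [integral_div, div_le_iff₀ (Real.exp_pos _), ← Real.exp_add, add_comm]
  exact key
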